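/- For every integer $p\ge 1$ define $$R_p:=\frac{(-1)^{p-1}}{2p\cdot 8^{p}}\left\{1+\sum_{k=1}^{p}\binom{p}{k}(-4)^{k}B_{2k}\left(\tfrac12\right)\right\},$$ where $B_{2k}(x)$ is the Bernoulli polynomial of order $2k$. Let $n$ be a positive integer and put $m:=\frac{n(n+1)}{2}$. Let $\gamma$ denote Euler's constant. Then, for every integer $r\ge 1$, there exists a real number $\Theta_r$ (which may depend on $n$ as well as on $r$) with $0<\Theta_r<1$ such that $$1+\frac12+\frac13+\cdots+\frac1n=\frac12\ln(2m)+\gamma+\sum_{p=1}^{r}\frac{R_p}{m^{p}}+\Theta_r\cdot\frac{R_{r+1}}{m^{r+1}}.$$ -/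

import Mathlib

/-- The coefficient
`R_p = (-1)^(p-1) / (2p * 8^p) * (1 + ∑_{k=1}^p C(p,k) (-4)^k B_{2k}(1/2))` for `p ≥ 1`,
where `B_{2k}(x)` is the Bernoulli polynomial of order `2k`. -/
noncomputable def ramanujanCoeff (p : ℕ) : ℚ :=
  (-1) ^ (p - 1) / (2 * (p : ℚ) * 8 ^ p) *
    (1 + ∑ k ∈ Finset.Icc 1 p,
      (p.choose k : ℚ) * (-4) ^ k * (Polynomial.bernoulli (2 * k)).eval (1 / 2))

/-! With `x = n + 1/2` one has `x² = 2m + 1/4`. Binet's formula at half-integers reads `H_n - γ =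
log x + ∫ 2t w(t)/(t² + x²) dt` over `t > 0`, where `w` is `fermiWeight`. Also `log x - log(2m)/2 =
∫ (1/2)/(s + 2m) ds` over `(0, 1/4)`. Hence `H_n - γ - log(2m)/2` is a Stieltjes transform, at `N =
2m`, of a positive measure. Expanding `1/(s + N)` geometrically leaves a remainder strictly between
0 and the first omitted term (`stieltjes_enveloping`). The moments of the measure are the `R_p` up
to sign and powers of 2 (`ramanujanCoeff_eq_moment`). -/

open MeasureTheory Set Filter Topology

/-! ### The weight and its odd moments -/

/-- The Fermi–Dirac type weight `1 / (e^{2πt} + 1)`. -/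
noncomputable def fermiWeight (t : ℝ) : ℝ := 1 / (Real.exp (2 * Real.pi * t) + 1)

lemma fermiWeight_pos (t : ℝ) : 0 < fermiWeight t := by
  unfold fermiWeight; positivity

lemma continuous_fermiWeight : Continuous fermiWeight := by
  unfold fermiWeight
  refine continuous_const.div (by fun_prop) fun t => ?_
  positivity

lemma fermiWeight_le_exp (t : ℝ) : fermiWeight t ≤ Real.exp (-(2 * Real.pi) * t) := by
  unfold fermiWeight
  rw [neg_mul, Real.exp_neg, ← one_div]
  exact one_div_le_one_div_of_le (Real.exp_pos _) (by linarith)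

lemma hasSum_fermiWeight {t : ℝ} (ht : 0 < t) :
    HasSum (fun n : ℕ => (-1 : ℝ) ^ n * Real.exp (-(2 * Real.pi * (n + 1)) * t))
      (fermiWeight t) := by
  set q := Real.exp (-(2 * Real.pi) * t) with hq
  have hq0 : 0 < q := Real.exp_pos _
  have hq1 : q < 1 := by
    rw [hq, Real.exp_lt_one_iff]
    have := mul_pos Real.two_pi_pos ht
    linarith
  have h := (hasSum_geometric_of_abs_lt_one (r := -q)
    (by rw [abs_neg, abs_of_pos hq0]; exact hq1)).mul_left q
  convert! h using 1
  · funext n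
    rw [neg_pow q, mul_left_comm, ← pow_succ', hq, ← Real.exp_nat_mul]
    congr 2
    push_cast
    ring
  · rw [fermiWeight, show 2 * Real.pi * t = -(-(2 * Real.pi) * t) by ring, Real.exp_neg, ← hq,
      sub_neg_eq_add]
    field_simp

lemma integrableOn_pow_mul_exp_neg (j : ℕ) {a : ℝ} (ha : 0 < a) :
    IntegrableOn (fun t : ℝ => t ^ j * Real.exp (-a * t)) (Ioi 0) := by
  have h := integrableOn_rpow_mul_exp_neg_mul_rpow (p := 1) (s := j) (b := a)
    (by have : (0 : ℝ) ≤ j := j.cast_nonneg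
        linarith) one_pos ha
  simpa using h

lemma integral_pow_mul_exp_neg (j : ℕ) {a : ℝ} (ha : 0 < a) :
    ∫ t in Ioi (0 : ℝ), t ^ j * Real.exp (-a * t) = j.factorial / a ^ (j + 1) := by
  have h := Real.integral_rpow_mul_exp_neg_mul_Ioi (a := j + 1) (r := a) (by positivity) ha
  rw [Real.Gamma_nat_eq_factorial] at h
  simp only [add_sub_cancel_right, Real.rpow_natCast, ← neg_mul] at h
  rw [h, ← Nat.cast_succ, Real.rpow_natCast]
  simp [div_eq_inv_mul]

lemma integrableOn_pow_mul_fermiWeight (j : ℕ) :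
    IntegrableOn (fun t : ℝ => t ^ j * fermiWeight t) (Ioi 0) := by
  refine (integrableOn_pow_mul_exp_neg j Real.two_pi_pos).mono'
    ((continuous_pow j).mul continuous_fermiWeight).aestronglyMeasurable ?_
  filter_upwards [ae_restrict_mem measurableSet_Ioi] with t ht
  have ht : 0 < t := ht
  rw [Real.norm_of_nonneg (by have := fermiWeight_pos t; positivity)]
  exact mul_le_mul_of_nonneg_left (fermiWeight_le_exp t) (by positivity)

/-- Termwise integration of the geometric series; `1 ≤ j` makes the majorants, of order `(n +
1)^(-(j + 1))`, summable. -/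
lemma hasSum_integral_mul_fermiWeight {g : ℝ → ℝ} (hg : Continuous g) {C : ℝ} {j : ℕ}
    (hj : 1 ≤ j) (hb : ∀ t, 0 < t → |g t| ≤ C * t ^ j) :
    HasSum (fun n : ℕ =>
        (-1 : ℝ) ^ n * ∫ t in Ioi (0 : ℝ), g t * Real.exp (-(2 * Real.pi * (n + 1)) * t))
      (∫ t in Ioi (0 : ℝ), g t * fermiWeight t) := by
  have ha : ∀ n : ℕ, 0 < 2 * Real.pi * ((n : ℝ) + 1) := fun n => by positivity
  have hdom : ∀ n : ℕ, IntegrableOn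
      (fun t : ℝ => C * (t ^ j * Real.exp (-(2 * Real.pi * (n + 1)) * t))) (Ioi 0) :=
    fun n => (integrableOn_pow_mul_exp_neg j (ha n)).const_mul C
  have hle : ∀ n : ℕ, ∀ᵐ t ∂(volume.restrict (Ioi (0 : ℝ))),
      ‖(-1 : ℝ) ^ n * (g t * Real.exp (-(2 * Real.pi * (n + 1)) * t))‖ ≤
        C * (t ^ j * Real.exp (-(2 * Real.pi * (n + 1)) * t)) := fun n => by
    filter_upwards [ae_restrict_mem measurableSet_Ioi] with t ht
    rw [norm_mul, norm_pow, norm_neg, norm_one, one_pow, one_mul, norm_mul, Real.norm_eq_abs,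
      Real.norm_eq_abs, abs_of_pos (Real.exp_pos _), ← mul_assoc]
    exact mul_le_mul_of_nonneg_right (hb t ht) (Real.exp_pos _).le
  have hint : ∀ n : ℕ, Integrable
      (fun t : ℝ => (-1 : ℝ) ^ n * (g t * Real.exp (-(2 * Real.pi * (n + 1)) * t)))
      (volume.restrict (Ioi 0)) := fun n =>
    (hdom n).mono' (by fun_prop : Continuous _).aestronglyMeasurable (hle n)
  have hsum : Summable fun n : ℕ => ∫ t in Ioi (0 : ℝ),
      ‖(-1 : ℝ) ^ n * (g t * Real.exp (-(2 * Real.pi * (n + 1)) * t))‖ := by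
    have hs : Summable fun n : ℕ =>
        C * (j.factorial / (2 * Real.pi) ^ (j + 1)) * (1 / ((n : ℝ) + 1) ^ (j + 1)) := by
      refine Summable.mul_left _ ?_
      have := (summable_nat_add_iff 1).mpr
        (Real.summable_one_div_nat_pow (p := j + 1).mpr (by omega))
      exact_mod_cast this
    refine Summable.of_nonneg_of_le (fun n => integral_nonneg fun t => norm_nonneg _)
      (fun n => ?_) hs
    refine (integral_mono_ae (hint n).norm (hdom n) (hle n)).trans (le_of_eq ?_)
    rw [integral_const_mul, integral_pow_mul_exp_neg j (ha n), mul_pow]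
    field_simp
  have h := hasSum_integral_of_summable_integral_norm hint hsum
  convert! h using 1
  · funext n
    rw [integral_const_mul]
  · refine setIntegral_congr_fun measurableSet_Ioi fun t ht => ?_
    have := (hasSum_fermiWeight ht).mul_left (g t)
    rw [← this.tsum_eq]
    exact tsum_congr fun n => by ring

/-- Termwise integration gives an alternating zeta series, which is the Fourier series of `B_{2k}`
at `1/2`. -/
lemma integral_pow_mul_fermiWeight {k : ℕ} (hk : 1 ≤ k) :
    ∫ t in Ioi (0 : ℝ), t ^ (2 * k - 1) * fermiWeight t =
      (-1) ^ k * (((Polynomial.bernoulli (2 * k)).eval (1 / 2) : ℚ) : ℝ) / (4 * k) := by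
  have h1 := hasSum_integral_mul_fermiWeight (g := fun t => t ^ (2 * k - 1)) (by fun_prop)
    (C := 1) (j := 2 * k - 1) (by omega) (fun t ht => by
      rw [one_mul, abs_of_pos (by positivity)])
  have h2 := hasSum_one_div_nat_pow_mul_cos (k := k) (by omega) (x := 1 / 2) (by norm_num)
  rw [← hasSum_nat_add_iff' 1] at h2
  have h3 := h2.mul_left (-((2 * k - 1).factorial / (2 * Real.pi) ^ (2 * k)))
  have h4 := h1.unique (f := fun n : ℕ => _) (by
    convert! h3 using 1
    funext n
    have hc : Real.cos (2 * Real.pi * ((n + 1 : ℕ) : ℝ) * (1 / 2)) = (-1) ^ (n + 1) := by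
      rw [← Real.cos_nat_mul_pi (n + 1)]
      congr 1
      ring
    rw [integral_pow_mul_exp_neg _ (by positivity), hc, show 2 * k - 1 + 1 = 2 * k by omega,
      mul_pow]
    push_cast
    field_simp
    ring)
  rw [h4]
  have hev : (Polynomial.map (algebraMap ℚ ℝ) (Polynomial.bernoulli (2 * k))).eval (1 / 2) =
      (((Polynomial.bernoulli (2 * k)).eval (1 / 2) : ℚ) : ℝ) := by
    rw [show (1 / 2 : ℝ) = algebraMap ℚ ℝ (1 / 2) by simp, Polynomial.eval_map_algebraMap,
      Polynomial.aeval_algebraMap_apply]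
    simp [Polynomial.aeval_def, Polynomial.eval₂_eq_eval_map]
  have hf : ((2 * k).factorial : ℝ) = 2 * k * (2 * k - 1).factorial := by
    rw [← Nat.mul_factorial_pred (by omega : 2 * k ≠ 0)]
    push_cast
    ring
  have hk0 : (k : ℝ) ≠ 0 := by positivity
  rw [hev, hf]
  -- The index-0 term removed above is `1 / 0 = 0`.
  have hz : ∑ i ∈ Finset.range 1, 1 / (i : ℝ) ^ (2 * k) *
      Real.cos (2 * Real.pi * i * (1 / 2)) = 0 := by
    simp; omega
  rw [hz, sub_zero]
  field_simp
  ring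

/-! ### Sine transform of the weight -/

lemma integral_exp_neg_mul_sin {a : ℝ} (ha : 0 < a) (b : ℝ) :
    ∫ t in Ioi (0 : ℝ), Real.exp (-a * t) * Real.sin (b * t) = b / (a ^ 2 + b ^ 2) := by
  have hre : (-(a : ℂ) + b * Complex.I).re < 0 := by simpa using ha
  have h := integral_exp_mul_complex_Ioi hre 0
  have hi := integrableOn_exp_mul_complex_Ioi hre 0
  have h2 := congrArg Complex.im h
  rw [← Complex.imCLM_apply, ← Complex.imCLM.integral_comp_comm hi] at h2
  have e : ∀ t : ℝ, Complex.imCLM (Complex.exp ((-(a : ℂ) + b * Complex.I) * t)) =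
      Real.exp (-a * t) * Real.sin (b * t) := fun t => by
    simp [Complex.exp_im]
  simp only [e] at h2
  rw [h2]
  simp [Complex.div_im, Complex.normSq_apply]
  ring

/-- Mittag-Leffler expansion of the cotangent at the imaginary point `iv/(2π)`. -/
lemma hasSum_two_mul_div_sq_add_sq {v : ℝ} (hv : 0 < v) :
    HasSum (fun n : ℕ => 2 * v / (v ^ 2 + (2 * Real.pi * (n + 1)) ^ 2))
      (1 / 2 * (Real.cosh (v / 2) / Real.sinh (v / 2)) - 1 / v) := by
  set z : ℂ := (v / (2 * Real.pi) : ℝ) * Complex.I with hzdef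
  have hπ : (Real.pi : ℂ) ≠ 0 := by exact_mod_cast Real.pi_ne_zero
  have hvC : (v : ℂ) ≠ 0 := by exact_mod_cast hv.ne'
  have hz : z ∈ Complex.integerComplement := by
    rw [Complex.mem_integerComplement_iff]
    rintro ⟨n, hn⟩
    have := congrArg Complex.im hn
    rw [hzdef, Complex.im_ofReal_mul, Complex.I_im, Complex.intCast_im, mul_one] at this
    have h0 : 0 < v / (2 * Real.pi) := by positivity
    linarith
  have hs := (summable_cotTerm hz).hasSum
  have hrep := cot_series_rep' hz
  have hsum : HasSum (fun n => cotTerm z n) (Real.pi * Complex.cot (Real.pi * z) - 1 / z) := by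
    rw [hrep]
    exact hs
  have harg : (Real.pi : ℂ) * z = ((v / 2 : ℝ) : ℂ) * Complex.I := by
    rw [hzdef]
    push_cast
    field_simp
  have h := hsum.mul_left (Complex.I / (2 * Real.pi))
  rw [← Complex.hasSum_ofReal]
  convert! h using 1
  · funext n
    rw [cotTerm_identity hz]
    have hd : (z + (n + 1)) * (z - (n + 1)) =
        -((v ^ 2 + (2 * Real.pi * (n + 1)) ^ 2 : ℝ) : ℂ) / (2 * Real.pi) ^ 2 := by
      rw [hzdef]
      push_cast
      field_simp
      ring_nf
      rw [Complex.I_sq]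
      ring
    have hD : ((v ^ 2 + (2 * Real.pi * (n + 1)) ^ 2 : ℝ) : ℂ) ≠ 0 := by
      exact_mod_cast (by positivity : (0 : ℝ) < v ^ 2 + (2 * Real.pi * (n + 1)) ^ 2).ne'
    rw [hd, Complex.ofReal_div, hzdef]
    push_cast at hD ⊢
    field_simp
    rw [Complex.I_sq]
    ring
  · have hsh : (Real.sinh (v / 2) : ℂ) ≠ 0 := by
      exact_mod_cast (Real.sinh_pos_iff.mpr (by positivity : 0 < v / 2)).ne'
    rw [harg, Complex.cot, Complex.cos_mul_I, Complex.sin_mul_I, ← Complex.ofReal_cosh,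
      ← Complex.ofReal_sinh, hzdef]
    push_cast at hsh ⊢
    field_simp

lemma hasSum_neg_one_pow_mul {a : ℕ → ℝ} {A B : ℝ} (hA : HasSum a A)
    (hB : HasSum (fun n => a (2 * n + 1)) B) : HasSum (fun n => (-1) ^ n * a n) (A - 2 * B) := by
  have hinj : Function.Injective fun n : ℕ => 2 * n + 1 := fun m n h => by
    have : 2 * m + 1 = 2 * n + 1 := h
    omega
  have hodd : HasSum (fun n => if Odd n then a n else 0) B := by
    rw [← hinj.hasSum_iff]
    · convert! hB using 2 with n
      exact if_pos ⟨n, rfl⟩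
    · rintro m hm
      refine if_neg fun ⟨k, hk⟩ => hm ⟨k, hk.symm⟩
  convert! hA.sub (hodd.mul_left 2) using 1
  funext n
  by_cases hn : Odd n
  · rw [if_pos hn, hn.neg_one_pow]
    ring
  · rw [if_neg hn, (Nat.not_odd_iff_even.mp hn).neg_one_pow]
    ring

lemma integral_sin_mul_fermiWeight {u : ℝ} (hu : 0 < u) :
    2 * ∫ t in Ioi (0 : ℝ), Real.sin (u * t) * fermiWeight t =
      1 / u - 1 / (2 * Real.sinh (u / 2)) := by
  have h1 := hasSum_integral_mul_fermiWeight (g := fun t => Real.sin (u * t)) (by fun_prop)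
    (C := u) (j := 1) le_rfl (fun t ht => by
      rw [pow_one]
      exact Real.abs_sin_le_abs.trans_eq (abs_of_pos (mul_pos hu ht)))
  have hA := hasSum_two_mul_div_sq_add_sq hu
  -- The odd-index terms form the same series at `u/2`, halved; `coth(u/2) - coth(u/4) =
  -- -1/sinh(u/2)` then closes the sum.
  have hB := (hasSum_two_mul_div_sq_add_sq (half_pos hu)).mul_left (1 / 2)
  have h2 := hasSum_neg_one_pow_mul hA (by
    convert! hB using 1
    funext n
    push_cast
    field_simp
    ring)
  have h3 := (h1.mul_left 2).unique (by
    convert! h2 using 1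
    funext n
    have := integral_exp_neg_mul_sin (a := 2 * Real.pi * (n + 1)) (by positivity) u
    simp only [mul_comm (Real.sin _), this]
    ring)
  rw [h3]
  have hs : 0 < Real.sinh (u / 2 / 2) := Real.sinh_pos_iff.mpr (by positivity)
  have hc : 0 < Real.cosh (u / 2 / 2) := Real.cosh_pos _
  have e : u / 2 = 2 * (u / 2 / 2) := by ring
  rw [show Real.sinh (u / 2) = 2 * Real.sinh (u / 2 / 2) * Real.cosh (u / 2 / 2) by
      conv_lhs => rw [e]
      exact Real.sinh_two_mul _,
    show Real.cosh (u / 2) = 2 * Real.cosh (u / 2 / 2) ^ 2 - 1 by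
      conv_lhs => rw [e]
      rw [Real.cosh_two_mul, Real.sinh_sq]
      ring]
  field_simp
  ring

/-! ### Binet-type formula for harmonic numbers -/

/-- The remainder `ψ(x + 1/2) - log x` of the digamma function, as a Stieltjes integral. -/
noncomputable def digammaRemainder (x : ℝ) : ℝ :=
  ∫ t in Ioi (0 : ℝ), 2 * t * fermiWeight t / (t ^ 2 + x ^ 2)

lemma integrable_exp_mul_sin_mul_fermiWeight {x : ℝ} (hx : 0 < x) :
    Integrable (Function.uncurry fun t u : ℝ =>
        2 * (Real.exp (-x * u) * Real.sin (t * u)) * fermiWeight t)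
      ((volume.restrict (Ioi (0 : ℝ))).prod (volume.restrict (Ioi (0 : ℝ)))) := by
  have hw : Integrable (fun t => 2 * fermiWeight t) (volume.restrict (Ioi (0 : ℝ))) := by
    simpa using! (integrableOn_pow_mul_fermiWeight 0).const_mul 2
  have he : Integrable (fun u => Real.exp (-x * u)) (volume.restrict (Ioi (0 : ℝ))) :=
    integrableOn_exp_mul_Ioi (neg_lt_zero.mpr hx) 0
  refine (hw.mul_prod he).mono' ?_ (ae_of_all _ fun ⟨t, u⟩ => ?_)
  · have := continuous_fermiWeight
    exact (by fun_prop : Continuous (fun p : ℝ × ℝ =>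
      2 * (Real.exp (-x * p.2) * Real.sin (p.1 * p.2)) * fermiWeight p.1)).aestronglyMeasurable
  · simp only [Function.uncurry_apply_pair, norm_mul, Real.norm_eq_abs, Nat.abs_ofNat,
      abs_of_pos (Real.exp_pos _), abs_of_pos (fermiWeight_pos t)]
    have h1 := Real.abs_sin_le_one (t * u)
    have h2 := fermiWeight_pos t
    calc 2 * (Real.exp (-x * u) * |Real.sin (t * u)|) * fermiWeight t
        ≤ 2 * (Real.exp (-x * u) * 1) * fermiWeight t := by gcongr
      _ = 2 * fermiWeight t * Real.exp (-x * u) := by ring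

lemma exp_mul_integral_sin_mul_fermiWeight (x : ℝ) {u : ℝ} (hu : 0 < u) :
    ∫ t in Ioi (0 : ℝ), 2 * (Real.exp (-x * u) * Real.sin (t * u)) * fermiWeight t =
      Real.exp (-x * u) * (1 / u - 1 / (2 * Real.sinh (u / 2))) := by
  rw [← integral_sin_mul_fermiWeight hu, ← integral_const_mul, ← integral_const_mul]
  refine integral_congr_ae (ae_of_all _ fun t => ?_)
  simp only [mul_comm t u]
  ring

lemma integrableOn_exp_mul_sub {x : ℝ} (hx : 0 < x) :
    IntegrableOn (fun u => Real.exp (-x * u) * (1 / u - 1 / (2 * Real.sinh (u / 2))))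
      (Ioi 0) := by
  refine (integrable_exp_mul_sin_mul_fermiWeight hx).integral_prod_right.congr ?_
  filter_upwards [ae_restrict_mem measurableSet_Ioi] with u hu
  exact exp_mul_integral_sin_mul_fermiWeight x hu

/-- Fubini, since `t/(t² + x²)` is the Laplace transform of `sin(tu)`. -/
lemma digammaRemainder_eq_laplace {x : ℝ} (hx : 0 < x) :
    digammaRemainder x =
      ∫ u in Ioi (0 : ℝ), Real.exp (-x * u) * (1 / u - 1 / (2 * Real.sinh (u / 2))) := by
  rw [← setIntegral_congr_fun measurableSet_Ioi fun u hu =>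
    exp_mul_integral_sin_mul_fermiWeight x hu,
    ← integral_integral_swap (integrable_exp_mul_sin_mul_fermiWeight hx), digammaRemainder]
  refine integral_congr_ae (ae_of_all _ fun t => ?_)
  simp only
  rw [integral_mul_const, integral_const_mul, integral_exp_neg_mul_sin hx, add_comm (x ^ 2)]
  ring

lemma digammaRemainder_sub {x : ℝ} (hx : 0 < x) :
    digammaRemainder x - digammaRemainder (x + 1) =
      Real.log ((x + 1) / x) - 1 / (x + 1 / 2) := by
  have hx1 : 0 < x + 1 := by linarith
  have hx2 : -(x + 1 / 2) < 0 := by linarith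
  have hexp := integrableOn_exp_mul_Ioi hx2 0
  have hi := (integrableOn_exp_mul_sub hx).sub (integrableOn_exp_mul_sub hx1)
  -- Because `e^(-xu) - e^(-(x+1)u) = 2 sinh(u/2) e^(-(x+1/2)u)`, the `sinh` cancels and a Frullani
  -- integrand remains.
  have key : ∀ u ∈ Ioi (0 : ℝ),
      Real.exp (-x * u) * (1 / u - 1 / (2 * Real.sinh (u / 2))) -
        Real.exp (-(x + 1) * u) * (1 / u - 1 / (2 * Real.sinh (u / 2))) +
        Real.exp (-(x + 1 / 2) * u) =
      u⁻¹ • (Real.exp (-(x * u)) - Real.exp (-((x + 1) * u))) := fun u hu => by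
    have hs : 0 < Real.sinh (u / 2) := Real.sinh_pos_iff.mpr (half_pos hu)
    have hu0 : u ≠ 0 := ne_of_gt hu
    have e1 : Real.exp (-x * u) = Real.exp (-(x + 1 / 2) * u) * Real.exp (u / 2) := by
      rw [← Real.exp_add]
      ring_nf
    have e2 : Real.exp (-(x + 1) * u) = Real.exp (-(x + 1 / 2) * u) * Real.exp (-(u / 2)) := by
      rw [← Real.exp_add]
      ring_nf
    rw [smul_eq_mul, ← neg_mul, ← neg_mul, e1, e2]
    field_simp
    rw [Real.sinh_eq]
    ring
  have hF := Frullani.integral_Ioi_eq (f := fun y : ℝ => Real.exp (-y)) (L := 1) (R := 0)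
    ((by fun_prop : Continuous _).locallyIntegrable.locallyIntegrableOn _) hx hx1
    (by
      have : Tendsto (fun y : ℝ => Real.exp (-y)) (𝓝 0) (𝓝 (Real.exp (-0))) :=
        (by fun_prop : Continuous fun y : ℝ => Real.exp (-y)).tendsto 0
      rw [neg_zero, Real.exp_zero] at this
      exact this.mono_left nhdsWithin_le_nhds)
    Real.tendsto_exp_neg_atTop_nhds_zero
    ((hi.add hexp).congr_fun key measurableSet_Ioi)
  rw [← setIntegral_congr_fun measurableSet_Ioi key] at hF
  rw [integral_add (by exact hi) hexp, integral_sub (integrableOn_exp_mul_sub hx)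
    (integrableOn_exp_mul_sub hx1), ← digammaRemainder_eq_laplace hx,
    ← digammaRemainder_eq_laplace hx1, integral_exp_mul_Ioi hx2] at hF
  have : x + 1 / 2 ≠ 0 := by positivity
  simp only [mul_zero, Real.exp_zero, sub_zero, smul_eq_mul, mul_one] at hF
  rw [← hF, neg_div_neg_eq]
  ring

lemma integrableOn_two_mul_fermiWeight_mul_pow (j : ℕ) :
    IntegrableOn (fun t => 2 * t * fermiWeight t * (t ^ 2 + 1 / 4) ^ j) (Ioi 0) := by
  have h : IntegrableOn (fun t => ∑ i ∈ Finset.range (j + 1),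
      2 * (1 / 4) ^ (j - i) * j.choose i * (t ^ (2 * i + 1) * fermiWeight t)) (Ioi 0) :=
    integrable_finsetSum _ fun i _ => (integrableOn_pow_mul_fermiWeight (2 * i + 1)).const_mul _
  refine h.congr_fun (fun t _ => ?_) measurableSet_Ioi
  simp only [add_pow, Finset.mul_sum]
  refine Finset.sum_congr rfl fun i _ => ?_
  rw [pow_succ t, pow_mul]
  ring

lemma digammaRemainder_nonneg (x : ℝ) : 0 ≤ digammaRemainder x :=
  setIntegral_nonneg measurableSet_Ioi fun t ht => by
    have := fermiWeight_pos t
    have ht : 0 < t := ht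
    positivity

lemma digammaRemainder_le {x : ℝ} (hx : 0 < x) :
    digammaRemainder x ≤ (∫ t in Ioi (0 : ℝ), 2 * t * fermiWeight t) / x ^ 2 := by
  rw [← integral_div]
  have hi : IntegrableOn (fun t => 2 * t * fermiWeight t) (Ioi 0) := by
    simpa using integrableOn_two_mul_fermiWeight_mul_pow 0
  refine integral_mono_of_nonneg ?_ (hi.div_const _) ?_ <;>
    filter_upwards [ae_restrict_mem measurableSet_Ioi] with t ht <;>
    have := fermiWeight_pos t <;> have ht : 0 < t := ht
  · simp only [Pi.zero_apply]
    positivity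
  · gcongr
    nlinarith

lemma tendsto_digammaRemainder : Tendsto digammaRemainder atTop (𝓝 0) := by
  have h : Tendsto (fun x : ℝ => (∫ t in Ioi (0 : ℝ), 2 * t * fermiWeight t) / x ^ 2)
      atTop (𝓝 0) := tendsto_const_nhds.div_atTop (tendsto_pow_atTop two_ne_zero)
  refine tendsto_of_tendsto_of_tendsto_of_le_of_le' tendsto_const_nhds h
    (Eventually.of_forall digammaRemainder_nonneg) ?_
  filter_upwards [eventually_gt_atTop 0] with x hx using digammaRemainder_le hx

/-- The difference equation makes the defect `D` constant in `n`, and its limit is `γ`. -/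
lemma harmonic_eq_log_add_digammaRemainder (n : ℕ) :
    (harmonic n : ℝ) = Real.log (n + 1 / 2) + Real.eulerMascheroniConstant +
      digammaRemainder (n + 1 / 2) := by
  set D : ℕ → ℝ := fun n => harmonic n - Real.log (n + 1 / 2) - digammaRemainder (n + 1 / 2)
    with hD
  have hstep : ∀ k, D (k + 1) = D k := fun k => by
    have hk : (0 : ℝ) < k + 1 / 2 := by positivity
    have h := digammaRemainder_sub hk
    rw [Real.log_div (by positivity) hk.ne'] at h
    simp only [hD, harmonic_succ]
    push_cast
    rw [show (k : ℝ) + 1 + 1 / 2 = k + 1 / 2 + 1 by ring]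
    rw [show (k : ℝ) + 1 / 2 + 1 / 2 = k + 1 by ring, one_div ((k : ℝ) + 1)] at h
    linarith
  have hconst : ∀ k, D k = D 0 := fun k => by
    induction k with
    | zero => rfl
    | succ k ih => rw [hstep, ih]
  have hcast : Tendsto (fun n : ℕ => (n : ℝ) + 1 / 2) atTop atTop :=
    tendsto_atTop_add_const_right _ _ tendsto_natCast_atTop_atTop
  have hlim : Tendsto D atTop (𝓝 Real.eulerMascheroniConstant) := by
    have h1 := Real.tendsto_harmonic_sub_log
    have h2 := (Real.tendsto_log_comp_add_sub_log (1 / 2)).comp tendsto_natCast_atTop_atTop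
    have h3 := tendsto_digammaRemainder.comp hcast
    convert! (h1.sub h2).sub h3 using 2
    · simp [hD]
    · ring
  have h0 : D 0 = Real.eulerMascheroniConstant :=
    tendsto_nhds_unique ((tendsto_congr hconst).mpr tendsto_const_nhds) hlim
  have hn : D n = Real.eulerMascheroniConstant := (hconst n).trans h0
  simp only [hD] at hn
  linarith

/-! ### Enveloping expansion -/

/-- Stieltjes transforms of positive measures envelop their asymptotic expansions. -/
lemma stieltjes_enveloping {α : Type*} [MeasurableSpace α] {μ : Measure α} (hμ : μ ≠ 0)
    {c s : α → ℝ} (hs : Measurable s) (hc0 : ∀ᵐ a ∂μ, 0 < c a) (hs0 : ∀ᵐ a ∂μ, 0 < s a)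
    (hi : ∀ j : ℕ, Integrable (fun a => c a * s a ^ j) μ) {N : ℝ} (hN : 0 < N) (r : ℕ) :
    ∃ ρ : ℝ, 0 < ρ ∧ ρ < (∫ a, c a * s a ^ r ∂μ) / N ^ (r + 1) ∧
      ∫ a, c a / (s a + N) ∂μ =
        ∑ j ∈ Finset.range r, (-1) ^ j * (∫ a, c a * s a ^ j ∂μ) / N ^ (j + 1) +
          (-1) ^ r * ρ := by
  have hpos : ∀ {f : α → ℝ}, Integrable f μ → (∀ᵐ a ∂μ, 0 < f a) → 0 < ∫ a, f a ∂μ :=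
    fun {f} hf hf0 => by
      rw [integral_pos_iff_support_of_nonneg_ae (hf0.mono fun a ha => ha.le) hf,
        measure_congr (t := univ)]
      · rwa [pos_iff_ne_zero, Ne, Measure.measure_univ_eq_zero]
      · filter_upwards [hf0] with a ha
        exact propext ⟨fun _ => trivial, fun _ => ha.ne'⟩
  have hdiv : ∀ j : ℕ, Integrable (fun a => c a * s a ^ j / (s a + N)) μ := fun j => by
    refine ((hi j).div_const N).mono'
      ((hi j).aemeasurable.div (hs.add_const N).aemeasurable).aestronglyMeasurable ?_
    filter_upwards [hc0, hs0] with a hc hs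
    rw [Real.norm_of_nonneg (by positivity)]
    gcongr
    linarith
  -- The exact geometric remainder; `1/(s + N) < 1/N` gives the upper bound.
  refine ⟨(∫ a, c a * s a ^ r / (s a + N) ∂μ) / N ^ r, ?_, ?_, ?_⟩
  · refine div_pos (hpos (hdiv r) ?_) (by positivity)
    filter_upwards [hc0, hs0] with a hc hs
    positivity
  · rw [pow_succ', ← div_div]
    gcongr
    rw [← integral_div, ← sub_pos, ← integral_sub ((hi r).div_const N) (hdiv r)]
    refine hpos (((hi r).div_const N).sub (hdiv r)) ?_
    filter_upwards [hc0, hs0] with a hc hs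
    rw [sub_pos]
    gcongr
    linarith
  · induction r with
    | zero => simp
    | succ r ih =>
      rw [ih, Finset.sum_range_succ]
      have h : ∫ a, c a * s a ^ (r + 1) / (s a + N) ∂μ =
          ∫ a, c a * s a ^ r ∂μ - N * ∫ a, c a * s a ^ r / (s a + N) ∂μ := by
        rw [← integral_const_mul, ← integral_sub (hi r) ((hdiv r).const_mul N)]
        refine integral_congr_ae ?_
        filter_upwards [hs0] with a hs
        field_simp
        ring
      rw [h]
      field_simp
      ring

/-! ### Identification of the coefficients and conclusion -/

/-- The interval `(0, 1/4)` yields the leading 1 in the braces; expanding `(t² + 1/4)^j` yields the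
Bernoulli terms. -/
lemma ramanujanCoeff_eq_moment (j : ℕ) :
    (2 : ℝ) ^ (j + 1) * (ramanujanCoeff (j + 1) : ℝ) =
      (-1) ^ j * ((∫ s in Ioo (0 : ℝ) (1 / 4), 1 / 2 * s ^ j) +
        ∫ t in Ioi (0 : ℝ), 2 * t * fermiWeight t * (t ^ 2 + 1 / 4) ^ j) := by
  have h1 : ∫ s in Ioo (0 : ℝ) (1 / 4), 1 / 2 * s ^ j = 1 / (2 * (j + 1) * 4 ^ (j + 1)) := by
    rw [← integral_Ioc_eq_integral_Ioo,
      ← intervalIntegral.integral_of_le (by norm_num), intervalIntegral.integral_const_mul,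
      integral_pow]
    simp
    field_simp
  have h2 : ∫ t in Ioi (0 : ℝ), 2 * t * fermiWeight t * (t ^ 2 + 1 / 4) ^ j =
      ∑ i ∈ Finset.range (j + 1), 2 * (1 / 4) ^ (j - i) * j.choose i *
        ((-1) ^ (i + 1) * (((Polynomial.bernoulli (2 * (i + 1))).eval (1 / 2) : ℚ) : ℝ) /
          (4 * (i + 1 : ℕ))) := by
    calc _ = ∫ t in Ioi (0 : ℝ), ∑ i ∈ Finset.range (j + 1),
          2 * (1 / 4) ^ (j - i) * j.choose i * (t ^ (2 * (i + 1) - 1) * fermiWeight t) := by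
          refine setIntegral_congr_fun measurableSet_Ioi fun t _ => ?_
          simp only [add_pow, Finset.mul_sum]
          refine Finset.sum_congr rfl fun i _ => ?_
          rw [show 2 * (i + 1) - 1 = 2 * i + 1 by omega, pow_succ t (2 * i), pow_mul]
          ring
      _ = _ := by
          rw [integral_finsetSum _ fun i _ =>
            (integrableOn_pow_mul_fermiWeight (2 * (i + 1) - 1)).const_mul _]
          refine Finset.sum_congr rfl fun i _ => ?_
          rw [integral_const_mul, integral_pow_mul_fermiWeight (Nat.le_add_left 1 i)]
  rw [h1, h2, ramanujanCoeff]
  rw [show Finset.Icc 1 (j + 1) = Finset.Ico 1 (j + 2) from rfl, Finset.sum_Ico_eq_sum_range,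
    Nat.add_sub_cancel, show j + 2 - 1 = j + 1 from rfl]
  push_cast
  rw [show (8 : ℝ) ^ (j + 1) = 2 ^ (j + 1) * 4 ^ (j + 1) by rw [← mul_pow]; norm_num,
    mul_add _ 1, mul_add, mul_add ((-1) ^ j), mul_one, Finset.mul_sum, Finset.mul_sum,
    Finset.mul_sum]
  congr 1
  · field_simp
  · refine Finset.sum_congr rfl fun i hi => ?_
    have hij : i ≤ j := Nat.lt_succ_iff.mp (Finset.mem_range.mp hi)
    have hch : ((j : ℝ) + 1) * j.choose i = (j + 1).choose (i + 1) * ((i : ℝ) + 1) := by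
      exact_mod_cast Nat.add_one_mul_choose_eq j i
    have hch' : (j.choose i : ℝ) = (j + 1).choose (i + 1) * ((i : ℝ) + 1) / (j + 1) := by
      rw [← hch]
      field_simp
    have h4 : (4 : ℝ) ^ (j + 1) = 4 ^ (j - i) * 4 ^ (i + 1) := by
      rw [← pow_add]
      congr 1
      omega
    rw [hch', h4, add_comm 1 i, neg_pow (4 : ℝ) (i + 1), one_div_pow]
    field_simp
    ring

theorem mainTheorem1 (n : ℕ) (hn : 1 ≤ n) (m : ℝ) (hm : m = (n : ℝ) * ((n : ℝ) + 1) / 2)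
    (r : ℕ) (hr : 1 ≤ r) :
    ∃ Θ : ℝ, 0 < Θ ∧ Θ < 1 ∧
      ∑ k ∈ Finset.Icc 1 n, 1 / (k : ℝ) =
        1 / 2 * Real.log (2 * m) + Real.eulerMascheroniConstant
          + ∑ p ∈ Finset.Icc 1 r, (ramanujanCoeff p : ℝ) / m ^ p
          + Θ * ((ramanujanCoeff (r + 1) : ℝ) / m ^ (r + 1)) := by
  have hn0 : (0 : ℝ) < n := by exact_mod_cast hn
  have hm0 : 0 < m := by rw [hm]; positivity
  have hN : 0 < 2 * m := by positivity
  have hx : ((n : ℝ) + 1 / 2) ^ 2 = 2 * m + 1 / 4 := by rw [hm]; ring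
  have hIoo : volume.restrict (Ioo (0 : ℝ) (1 / 4)) ≠ 0 := by
    simp [Measure.restrict_eq_zero]
  have hIoi : volume.restrict (Ioi (0 : ℝ)) ≠ 0 := by
    simp [Measure.restrict_eq_zero]
  obtain ⟨ρ₁, h₁0, h₁1, h₁⟩ := stieltjes_enveloping hIoo (c := fun _ => 1 / 2) (s := fun s => s)
    measurable_id (ae_of_all _ fun _ => by norm_num)
    ((ae_restrict_mem measurableSet_Ioo).mono fun s hs => hs.1)
    (fun j => ((by fun_prop : Continuous fun s : ℝ => 1 / 2 * s ^ j).integrableOn_Icc).mono_set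
      Ioo_subset_Icc_self) hN r
  obtain ⟨ρ₂, h₂0, h₂1, h₂⟩ := stieltjes_enveloping hIoi
    (c := fun t => 2 * t * fermiWeight t) (s := fun t => t ^ 2 + 1 / 4) (by fun_prop)
    ((ae_restrict_mem measurableSet_Ioi).mono fun t ht =>
      mul_pos (mul_pos two_pos ht) (fermiWeight_pos t))
    (ae_of_all _ fun t => by positivity) integrableOn_two_mul_fermiWeight_mul_pow hN r
  have hlog : ∫ s in Ioo (0 : ℝ) (1 / 4), 1 / 2 / (s + 2 * m) =
      Real.log (n + 1 / 2) - 1 / 2 * Real.log (2 * m) := by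
    rw [← integral_Ioc_eq_integral_Ioo, ← intervalIntegral.integral_of_le (by norm_num)]
    simp only [div_eq_mul_inv (1 / 2 : ℝ) (_ + _)]
    rw [intervalIntegral.integral_const_mul,
      intervalIntegral.integral_comp_add_right (fun y : ℝ => y⁻¹),
      integral_inv_of_pos (by linarith) (by linarith), zero_add, add_comm (1 / 4 : ℝ), ← hx,
      Real.log_div (by positivity) hN.ne', Real.log_pow]
    push_cast
    ring
  have hdig : ∫ t in Ioi (0 : ℝ), 2 * t * fermiWeight t / (t ^ 2 + 1 / 4 + 2 * m) =
      digammaRemainder (n + 1 / 2) := by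
    simp only [digammaRemainder, hx]
    refine integral_congr_ae (ae_of_all _ fun t => ?_)
    simp only
    ring_nf
  rw [hlog] at h₁
  rw [hdig] at h₂
  have hH : ∑ k ∈ Finset.Icc 1 n, 1 / (k : ℝ) = harmonic n := by
    rw [harmonic_eq_sum_Icc]
    push_cast
    simp
  have hcoef : ∀ j : ℕ, (ramanujanCoeff (j + 1) : ℝ) / m ^ (j + 1) =
      (-1) ^ j * (∫ s in Ioo (0 : ℝ) (1 / 4), 1 / 2 * s ^ j) / (2 * m) ^ (j + 1) +
        (-1) ^ j * (∫ t in Ioi (0 : ℝ), 2 * t * fermiWeight t * (t ^ 2 + 1 / 4) ^ j) /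
          (2 * m) ^ (j + 1) := fun j => by
    rw [← add_div, ← mul_add, ← ramanujanCoeff_eq_moment, mul_pow]
    field_simp
  have hsum : ∑ p ∈ Finset.Icc 1 r, (ramanujanCoeff p : ℝ) / m ^ p =
      ∑ j ∈ Finset.range r, (ramanujanCoeff (j + 1) : ℝ) / m ^ (j + 1) := by
    rw [show Finset.Icc 1 r = Finset.Ico 1 (r + 1) from rfl, Finset.sum_Ico_eq_sum_range,
      Nat.add_sub_cancel]
    simp only [add_comm 1]
  have hM := add_lt_add h₁1 h₂1
  -- Both remainders carry the sign `(-1)^r`, so `Θ` is their summed size over that of the omitted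
  -- terms.
  refine ⟨_, div_pos (add_pos h₁0 h₂0) ((add_pos h₁0 h₂0).trans hM),
    (div_lt_one ((add_pos h₁0 h₂0).trans hM)).mpr hM, ?_⟩
  rw [hH, harmonic_eq_log_add_digammaRemainder, hsum, Finset.sum_congr rfl fun j _ => hcoef j,
    Finset.sum_add_distrib, hcoef r, mul_div_assoc, mul_div_assoc, ← mul_add, mul_left_comm,
    div_mul_cancel₀ _ ((add_pos h₁0 h₂0).trans hM).ne']
  linarith
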